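/- Let $\mathbb D=\{z\in\mathbb C:|z|<1\}$ and let $d\mathcal A=dx\,dy/\pi$ be the normalized area measure on $\mathbb D$. An Orlicz function is a nonnegative, nondecreasing, convex function $\Psi:[0,\infty)\to[0,\infty)$ with $\Psi(0)=0$ and $\Psi(x)\to\infty$ as $x\to\infty$; for $y>0$, $\Psi^{-1}(y)$ denotes the unique $x\ge 0$ with $\Psi(x)=y$. For a positive measure $\nu$ on $\mathbb D$, $L^\Psi(\nu)$ is the space of (classes of) measurable $f:\mathbb D\to\mathbb C$ such that $\int_{\mathbb D}\Psi(|f|/C)\,d\nu<\infty$ for some $C>0$, with norm $\|f\|_{L^\Psi(\nu)}=\inf\{C>0:\int_{\mathbb D}\Psi(|f|/C)\,d\nu\le 1\}$, and the Bergman--Orlicz space $\mathfrak B^\Psi$ is the subspace of $L^\Psi(\mathcal A)$ of functions analytic in $\mathbb D$. For $|\xi|=1$ and $0<h<1$ put $$W(\xi,h)=\{z\in\mathbb D:\ |z|\ge 1-h,\ |\arg(z\overline\xi)|\le\pi h\},\qquad \rho_\mu(h)=\sup_{|\xi|=1}\mu(W(\xi,h)),\qquad K_{\mu,2}(h)=\sup_{0<t<h}\frac{\rho_\mu(t)}{t^2}.$$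 Theorem. Let $\mu$ be a finite positive Borel measure on $\mathbb D$, let $\Psi_1,\Psi_2$ be Orlicz functions, and let $I_\mu:\mathfrak B^{\Psi_1}\to L^{\Psi_2}(\mu)$ be the canonical map $I_\mu(f)=f$. (The right-hand sides below are read as $+\infty$ where the denominator vanishes.) 1) If $I_\mu$ is bounded (that is, it maps $\mathfrak B^{\Psi_1}$ into $L^{\Psi_2}(\mu)$ and $\|f\|_{L^{\Psi_2}(\mu)}\le M\|f\|_{\mathfrak B^{\Psi_1}}$ for some constant $M$ and all $f\in\mathfrak B^{\Psi_1}$), then there is a constant $A>0$ such that $$\rho_\mu(h)\le\frac{1}{\Psi_2\big[A\,\Psi_1^{-1}(1/h^2)\big]}\qquad\text{for all }0<h<1.$$ 2) Conversely, if there is a constant $A>0$ such that $$K_{\mu,2}(h)\le\frac{1/h^2}{\Psi_2\big[A\,\Psi_1^{-1}(1/h^2)\big]}\qquad\text{for all }0<h<1,$$ then $I_\mu$ is bounded. -/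

import Mathlib

open MeasureTheory Filter Set
open scoped ENNReal ComplexConjugate

/-- Orlicz functions: nonnegative nondecreasing convex functions on `[0, ∞)` with `Ψ 0 = 0` and
`Ψ x → ∞` as `x → ∞`. Only the values on `[0, ∞)` matter; nonnegativity follows from the fields. -/
structure IsOrlicz (Ψ : ℝ → ℝ) : Prop where
  convexOn : ConvexOn ℝ (Ici 0) Ψ
  monotoneOn : MonotoneOn Ψ (Ici 0)
  map_zero : Ψ 0 = 0
  tendsto_atTop : Tendsto Ψ atTop atTop

/-- The inverse `Ψ⁻¹` on `(0, ∞)`: for an Orlicz function `Ψ` and `y > 0`, this is the unique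
`x ≥ 0` with `Ψ x = y` (see `IsOrlicz.existsUnique_eq`). -/
noncomputable def orliczInv (Ψ : ℝ → ℝ) (y : ℝ) : ℝ := Function.invFunOn Ψ (Ici 0) y

/-- An Orlicz function takes each positive value at exactly one point of `[0, ∞)`. -/
theorem IsOrlicz.existsUnique_eq {Ψ : ℝ → ℝ} (h : IsOrlicz Ψ) {y : ℝ} (hy : 0 < y) :
    ∃! x : ℝ, x ∈ Ici (0 : ℝ) ∧ Ψ x = y := by
  have key : ∀ a b : ℝ, 0 ≤ a → a < b → Ψ a ≤ a / b * Ψ b := by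
    intro a b ha hab
    have hb : 0 < b := lt_of_le_of_lt ha hab
    have h1 : 0 ≤ 1 - a / b := by rw [sub_nonneg, div_le_one hb]; exact hab.le
    have h2 : 0 ≤ a / b := by positivity
    have := h.convexOn.2 (mem_Ici.2 (le_refl (0 : ℝ))) (mem_Ici.2 hb.le) h1 h2 (by ring)
    simp only [smul_eq_mul, h.map_zero, mul_zero, zero_add] at this
    rwa [div_mul_cancel₀ a hb.ne'] at this
  have hlt : ∀ a b : ℝ, 0 ≤ a → a < b → Ψ a = y → Ψ b = y → False := by
    intro a b ha hab h1 h2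
    have hb : 0 < b := lt_of_le_of_lt ha hab
    have h3 := key a b ha hab
    rw [h1, h2] at h3
    have h4 : a / b < 1 := (div_lt_one hb).2 hab
    nlinarith
  have hnn : ∀ x : ℝ, 0 ≤ x → 0 ≤ Ψ x := fun x hx => by
    have := h.monotoneOn (mem_Ici.2 le_rfl) (mem_Ici.2 hx) hx
    rwa [h.map_zero] at this
  have hcont : ContinuousOn Ψ (Ici 0) := by
    intro x hx
    rcases eq_or_lt_of_le (mem_Ici.1 hx) with rfl | hx'
    · have hlim : Tendsto (fun t : ℝ => t * Ψ 1) (nhdsWithin 0 (Ici 0)) (nhds 0) := by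
        have : Continuous (fun t : ℝ => t * Ψ 1) := by fun_prop
        simpa using (this.tendsto 0).mono_left nhdsWithin_le_nhds
      rw [ContinuousWithinAt, h.map_zero]
      refine tendsto_of_tendsto_of_tendsto_of_le_of_le' tendsto_const_nhds hlim ?_ ?_
      · filter_upwards [self_mem_nhdsWithin] with t ht using hnn t ht
      · filter_upwards [self_mem_nhdsWithin,
          mem_nhdsWithin_of_mem_nhds (Iio_mem_nhds (zero_lt_one' ℝ))] with t ht ht1
        simpa using key t 1 ht ht1
    · have : ContinuousOn Ψ (interior (Ici 0)) := h.convexOn.continuousOn_interior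
      rw [interior_Ici] at this
      exact (this.continuousAt (Ioi_mem_nhds hx')).continuousWithinAt
  obtain ⟨b, hb0, hb⟩ := ((eventually_ge_atTop (0 : ℝ)).and
    (h.tendsto_atTop.eventually_ge_atTop y)).exists
  obtain ⟨x, hx, hxy⟩ := intermediate_value_Icc hb0 (hcont.mono Icc_subset_Ici_self)
    (show y ∈ Icc (Ψ 0) (Ψ b) by rw [h.map_zero]; exact ⟨hy.le, hb⟩)
  refine ⟨x, ⟨hx.1, hxy⟩, ?_⟩
  rintro z ⟨hz, hzy⟩
  rcases lt_trichotomy z x with hzx | hzx | hzx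
  · exact (hlt z x hz hzx hzy hxy).elim
  · exact hzx
  · exact (hlt x z hx.1 hzx hxy hzy).elim

/-- The open unit disk of the complex plane. -/
def unitDisk : Set ℂ := Metric.ball 0 1

/-- The normalized area measure `dx dy / π` on the unit disk. -/
noncomputable def areaMeasure : Measure ℂ :=
  ENNReal.ofReal (1 / Real.pi) • (volume : Measure ℂ).restrict unitDisk

/-- The modular `∫ Ψ(|f| / C) dν`, with values in `[0, ∞]`. -/
noncomputable def orliczModular (Ψ : ℝ → ℝ) (ν : Measure ℂ) (f : ℂ → ℂ) (C : ℝ) : ℝ≥0∞ :=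
  ∫⁻ z, ENNReal.ofReal (Ψ (‖f z‖ / C)) ∂ν

/-- Membership in the Orlicz space `L^Ψ(ν)`. -/
def MemOrlicz (Ψ : ℝ → ℝ) (ν : Measure ℂ) (f : ℂ → ℂ) : Prop :=
  AEStronglyMeasurable f ν ∧ ∃ C : ℝ, 0 < C ∧ orliczModular Ψ ν f C < ∞

/-- The (Luxemburg) norm `‖f‖_Ψ` on `L^Ψ(ν)`. -/
noncomputable def orliczNorm (Ψ : ℝ → ℝ) (ν : Measure ℂ) (f : ℂ → ℂ) : ℝ :=
  sInf {C : ℝ | 0 < C ∧ orliczModular Ψ ν f C ≤ 1}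

/-- Membership in the Bergman-Orlicz space: `f` is analytic in the unit disk and belongs to the
Orlicz space of the normalized area measure. The values of `f` off the disk play no role. -/
def MemBergmanOrlicz (Ψ : ℝ → ℝ) (f : ℂ → ℂ) : Prop :=
  DifferentiableOn ℂ f unitDisk ∧ MemOrlicz Ψ areaMeasure f

/-- Boundedness of the embedding `I_μ f = f` from the Bergman-Orlicz space of `Ψ₁` to `L^Ψ₂(μ)`,
for a measure `μ` on the unit disk: it maps into `L^Ψ₂(μ)` and is a bounded operator. -/
def EmbeddingBounded (Ψ₁ Ψ₂ : ℝ → ℝ) (μ : Measure ℂ) : Prop :=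
  ∃ M : ℝ, ∀ f : ℂ → ℂ, MemBergmanOrlicz Ψ₁ f →
    MemOrlicz Ψ₂ μ f ∧ orliczNorm Ψ₂ μ f ≤ M * orliczNorm Ψ₁ areaMeasure f

/-- The Carleson window `W(ξ, h)`. -/
def carlesonWindow (ξ : ℂ) (h : ℝ) : Set ℂ :=
  {z ∈ unitDisk | 1 - h ≤ ‖z‖ ∧ |(z * conj ξ).arg| ≤ Real.pi * h}

/-- The Carleson function `ρ_μ(h)`: the supremum of `μ (W(ξ, h))` over `|ξ| = 1`. -/
noncomputable def carlesonRho (μ : Measure ℂ) (h : ℝ) : ℝ≥0∞ :=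
  ⨆ (ξ : ℂ) (_ : ‖ξ‖ = 1), μ (carlesonWindow ξ h)

/-- `K_{μ,2}(h)`: the supremum of `ρ_μ(t) / t²` over `0 < t < h`. -/
noncomputable def carlesonK (μ : Measure ℂ) (h : ℝ) : ℝ≥0∞ :=
  ⨆ (t : ℝ) (_ : t ∈ Ioo 0 h), carlesonRho μ t / ENNReal.ofReal (t ^ 2)

/-!
Both halves reduce to pointwise estimates on `|f|`; no maximal function is needed.

*Necessity.* For `a = (1 - h) ξ`, the function `f(z) = (h / (1 - conj a z))⁴` satisfies `|f| ≤ 1` on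
the disk and is bounded below by an absolute constant on the window `W(ξ, h)`. Moreover
`|f| ≤ h² |φ'|²`, where `φ` is the Möbius involution exchanging `a` and `0`, and `∫ |φ'|² dA ≤ 1`
because this integral is the area of `φ(𝔻)` (`lintegral_norm_deriv_mobius_sq_le`). By convexity
`∫ Ψ₁(x |f|) dA ≤ Ψ₁(x) ∫ |f| dA ≤ 1` for `x = Ψ₁⁻¹(1 / h²)`, so `f` has norm at most `1 / x`
(`orliczModular_testFunction_le`), and boundedness of the embedding gives the estimate by
Chebyshev's inequality.

*Sufficiency.* Suppose `∫ Ψ₁(|f|) dA ≤ 1`. As `Ψ₁(|f|)` is subharmonic,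
`((1 - |z|) / 2)² Ψ₁(|f(z)|) ≤ ∫ Ψ₁(|f|) dA` over the disk `D(z)` with centre `z` and radius
`(1 - |z|) / 2` (`IsOrlicz.map_norm_le_lintegral_ball_areaMeasure`). In particular
`Ψ₁(|f(z)|) ≤ 4 / (1 - |z|)²`, so the hypothesis on `K`, read at the scale `H` with
`1 / H² = Ψ₁(|f(z)|) / 256`, applies to all windows of size comparable to `1 - |z|`; it bounds
`ρ(t) Ψ₂(A |f(z)| / 256)` by `t² Ψ₁(|f(z)|) / 256` (`carlesonRho_mul_le`). The points `z` with
`w ∈ D(z)` all lie in a single window at `w` of size `4 (1 - |w|)`, so inserting the sub-mean value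
inequality into `∫ Ψ₂(A |f| / 256) dμ` and exchanging the order of integration bounds the part of
this integral where `Ψ₁(|f|) > 256` (`setLIntegral_map_norm_div_le_one`). Where `Ψ₁(|f|) ≤ 256` the
integrand is bounded and `μ` is finite.
-/

/-! ### Orlicz functions -/

namespace IsOrlicz

variable {Ψ : ℝ → ℝ}

theorem nonneg (h : IsOrlicz Ψ) {x : ℝ} (hx : 0 ≤ x) : 0 ≤ Ψ x := by
  simpa [h.map_zero] using h.monotoneOn (mem_Ici.2 le_rfl) (mem_Ici.2 hx) hx

theorem mono (h : IsOrlicz Ψ) {x y : ℝ} (hx : 0 ≤ x) (hxy : x ≤ y) : Ψ x ≤ Ψ y :=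
  h.monotoneOn (mem_Ici.2 hx) (mem_Ici.2 (hx.trans hxy)) hxy

theorem map_mul_le (h : IsOrlicz Ψ) {c x : ℝ} (hc : 0 ≤ c) (hc1 : c ≤ 1) (hx : 0 ≤ x) :
    Ψ (c * x) ≤ c * Ψ x := by
  simpa [h.map_zero] using h.convexOn.2 (mem_Ici.2 (le_refl (0 : ℝ))) (mem_Ici.2 hx)
    (sub_nonneg.2 hc1) hc (by ring)

theorem orliczInv_spec (h : IsOrlicz Ψ) {y : ℝ} (hy : 0 < y) :
    0 ≤ orliczInv Ψ y ∧ Ψ (orliczInv Ψ y) = y := by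
  obtain ⟨x, hx, -⟩ := h.existsUnique_eq hy
  have hex : ∃ a ∈ Ici (0 : ℝ), Ψ a = y := ⟨x, hx⟩
  exact ⟨Function.invFunOn_mem hex, Function.invFunOn_eq hex⟩

theorem orliczInv_pos (h : IsOrlicz Ψ) {y : ℝ} (hy : 0 < y) : 0 < orliczInv Ψ y := by
  obtain ⟨h0, h1⟩ := h.orliczInv_spec hy
  refine h0.lt_of_ne fun h2 => ?_
  rw [← h2, h.map_zero] at h1
  exact hy.ne h1

theorem le_orliczInv (h : IsOrlicz Ψ) {x y : ℝ} (hx : 0 ≤ x) (hy : 0 < y) (hxy : Ψ x ≤ y) :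
    x ≤ orliczInv Ψ y := by
  obtain ⟨h0, h1⟩ := h.orliczInv_spec hy
  by_contra! hlt
  have h2 : Ψ x = y := le_antisymm hxy (h1 ▸ h.mono h0 hlt.le)
  exact hlt.ne ((h.existsUnique_eq hy).unique ⟨h0, h1⟩ ⟨hx, h2⟩)

theorem convexOn_norm (h : IsOrlicz Ψ) : ConvexOn ℝ univ fun z : ℂ => Ψ ‖z‖ := by
  refine ⟨convex_univ, fun x _ y _ a b ha hb hab => ?_⟩
  calc Ψ ‖a • x + b • y‖ ≤ Ψ (a • ‖x‖ + b • ‖y‖) := by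
        refine h.mono (norm_nonneg _) ((norm_add_le _ _).trans ?_)
        simp [abs_of_nonneg ha, abs_of_nonneg hb]
    _ ≤ a • Ψ ‖x‖ + b • Ψ ‖y‖ :=
        h.convexOn.2 (mem_Ici.2 (norm_nonneg _)) (mem_Ici.2 (norm_nonneg _)) ha hb hab

theorem continuous_norm (h : IsOrlicz Ψ) : Continuous fun z : ℂ => Ψ ‖z‖ :=
  continuousOn_univ.1 (h.convexOn_norm.continuousOn isOpen_univ)

theorem continuous_norm_div (h : IsOrlicz Ψ) {C : ℝ} (hC : 0 < C) :
    Continuous fun z : ℂ => Ψ (‖z‖ / C) := by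
  have : (fun z : ℂ => Ψ (‖z‖ / C)) = (fun z : ℂ => Ψ ‖z‖) ∘ fun z => z / (C : ℂ) := by
    ext z
    simp [abs_of_pos hC]
  rw [this]
  exact h.continuous_norm.comp (by fun_prop)

end IsOrlicz

theorem measurableSet_unitDisk : MeasurableSet unitDisk := Metric.isOpen_ball.measurableSet

theorem mem_unitDisk {z : ℂ} : z ∈ unitDisk ↔ ‖z‖ < 1 := by simp [unitDisk]

/-! ### Modular and norm -/

theorem orliczModular_mul_le {Ψ : ℝ → ℝ} (h : IsOrlicz Ψ) (ν : Measure ℂ) (f : ℂ → ℂ) {C k : ℝ}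
    (hC : 0 < C) (hk : 1 ≤ k) :
    orliczModular Ψ ν f (k * C) ≤ ENNReal.ofReal k⁻¹ * orliczModular Ψ ν f C := by
  have hk0 : 0 < k := by linarith
  unfold orliczModular
  rw [← lintegral_const_mul' _ _ ENNReal.ofReal_ne_top]
  refine lintegral_mono fun z => ?_
  rw [← ENNReal.ofReal_mul (by positivity)]
  refine ENNReal.ofReal_le_ofReal ?_
  have := h.map_mul_le (c := k⁻¹) (x := ‖f z‖ / C) (by positivity) (inv_le_one_of_one_le₀ hk)
    (by positivity)
  convert this using 2
  field_simp

theorem orliczModular_anti {Ψ : ℝ → ℝ} (h : IsOrlicz Ψ) (ν : Measure ℂ) (f : ℂ → ℂ) {C D : ℝ}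
    (hC : 0 < C) (hCD : C ≤ D) : orliczModular Ψ ν f D ≤ orliczModular Ψ ν f C := by
  refine lintegral_mono fun z => ENNReal.ofReal_le_ofReal (h.mono ?_ ?_)
  · have := hC.trans_le hCD
    positivity
  · gcongr

theorem exists_orliczModular_le_one_of_lt_top {Ψ : ℝ → ℝ} (h : IsOrlicz Ψ) (ν : Measure ℂ)
    (f : ℂ → ℂ) {C : ℝ} (hC : 0 < C) (hfin : orliczModular Ψ ν f C < ∞) :
    ∃ D, 0 < D ∧ orliczModular Ψ ν f D ≤ 1 := by
  set B := (orliczModular Ψ ν f C).toReal with hB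
  have hB0 : 0 ≤ B := ENNReal.toReal_nonneg
  refine ⟨(1 + B) * C, by positivity, (orliczModular_mul_le h ν f hC (by linarith)).trans ?_⟩
  rw [← ENNReal.ofReal_toReal hfin.ne, ← hB, ← ENNReal.ofReal_mul (by positivity),
    ENNReal.ofReal_le_one, inv_mul_le_iff₀ (by positivity)]
  linarith

/-- Membership in the Orlicz space is what keeps the infimum defining the norm from being taken
over the empty set. -/
theorem orliczModular_le_one_of_norm_lt {Ψ : ℝ → ℝ} (h : IsOrlicz Ψ) {ν : Measure ℂ} {f : ℂ → ℂ}
    (hf : MemOrlicz Ψ ν f) {C : ℝ} (hC : orliczNorm Ψ ν f < C) : orliczModular Ψ ν f C ≤ 1 := by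
  obtain ⟨-, C₀, hC₀, hfin⟩ := hf
  obtain ⟨D, ⟨hD0, hD⟩, hDC⟩ := exists_lt_of_csInf_lt
    (exists_orliczModular_le_one_of_lt_top h ν f hC₀ hfin) hC
  exact (orliczModular_anti h ν f hD0 hDC.le).trans hD

theorem orliczNorm_le {Ψ : ℝ → ℝ} {ν : Measure ℂ} {f : ℂ → ℂ} {C : ℝ} (hC : 0 < C)
    (h : orliczModular Ψ ν f C ≤ 1) : orliczNorm Ψ ν f ≤ C :=
  csInf_le ⟨0, fun _ hx => hx.1.le⟩ ⟨hC, h⟩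

theorem orliczNorm_nonneg (Ψ : ℝ → ℝ) (ν : Measure ℂ) (f : ℂ → ℂ) : 0 ≤ orliczNorm Ψ ν f :=
  Real.sInf_nonneg fun _ hx => hx.1.le

/-! ### Necessity: testing on powers of the Bergman kernel -/

theorem det_toSpanSingleton_restrictScalars (d : ℂ) :
    ((ContinuousLinearMap.toSpanSingleton ℂ d).restrictScalars ℝ).det = ‖d‖ ^ 2 := by
  have h : (((ContinuousLinearMap.toSpanSingleton ℂ d).restrictScalars ℝ : ℂ →L[ℝ] ℂ) : ℂ →ₗ[ℝ] ℂ)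
      = ((ContinuousLinearMap.toSpanSingleton ℂ d : ℂ →L[ℂ] ℂ) : ℂ →ₗ[ℂ] ℂ).restrictScalars ℝ := rfl
  rw [ContinuousLinearMap.det, h, LinearMap.det_restrictScalars, Algebra.norm_complex_apply,
    Complex.normSq_eq_norm_sq]
  simp

theorem one_sub_norm_le_norm_one_sub {a z : ℂ} (hz : ‖z‖ < 1) :
    1 - ‖a‖ ≤ ‖1 - conj a * z‖ := by
  have h1 := norm_sub_norm_le (1 : ℂ) (conj a * z)
  have h2 : ‖conj a * z‖ ≤ ‖a‖ := by
    rw [norm_mul, RCLike.norm_conj]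
    exact mul_le_of_le_one_right (norm_nonneg _) hz.le
  rw [norm_one] at h1
  linarith

theorem hasDerivAt_mobius {a z : ℂ} (hz : 1 - conj a * z ≠ 0) :
    HasDerivAt (fun w => (a - w) / (1 - conj a * w))
      ((conj a * a - 1) / (1 - conj a * z) ^ 2) z := by
  have h1 : HasDerivAt (fun w : ℂ => a - w) (-1) z := (hasDerivAt_id z).const_sub a
  have h2 : HasDerivAt (fun w : ℂ => 1 - conj a * w) (-(conj a * 1)) z :=
    ((hasDerivAt_id z).const_mul (conj a)).const_sub 1
  refine (h1.div h2 hz).congr_deriv ?_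
  congr 1
  ring

theorem mobius_mem_unitDisk {a z : ℂ} (ha : ‖a‖ < 1) (hz : ‖z‖ < 1) :
    (a - z) / (1 - conj a * z) ∈ unitDisk := by
  have h0 := one_sub_norm_le_norm_one_sub (a := a) hz
  have hpos : 0 < ‖1 - conj a * z‖ := by linarith
  rw [mem_unitDisk, norm_div, div_lt_one hpos]
  refine lt_of_pow_lt_pow_left₀ 2 hpos.le ?_
  have key : ‖1 - conj a * z‖ ^ 2 - ‖a - z‖ ^ 2 = (1 - ‖a‖ ^ 2) * (1 - ‖z‖ ^ 2) := by
    simp only [← Complex.normSq_eq_norm_sq, Complex.normSq_apply, Complex.sub_re, Complex.sub_im,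
      Complex.mul_re, Complex.mul_im, Complex.conj_re, Complex.conj_im, Complex.one_re,
      Complex.one_im]
    ring
  have h1 : 0 < 1 - ‖a‖ ^ 2 := by nlinarith [norm_nonneg a]
  have h2 : 0 < 1 - ‖z‖ ^ 2 := by nlinarith [norm_nonneg z]
  nlinarith [mul_pos h1 h2]

theorem mobius_injOn {a : ℂ} (ha : ‖a‖ < 1) :
    InjOn (fun w => (a - w) / (1 - conj a * w)) unitDisk := by
  have hne : ∀ z ∈ unitDisk, 1 - conj a * z ≠ 0 := fun z hz => norm_pos_iff.1 <|
    (sub_pos.2 ha).trans_le (one_sub_norm_le_norm_one_sub (mem_unitDisk.1 hz))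
  intro z hz w hw h
  have h' := (div_eq_div_iff (hne z hz) (hne w hw)).1 h
  have h1 : (conj a * a - 1) * (z - w) = 0 := by linear_combination h'
  have h2 : conj a * a - 1 ≠ 0 := by
    rw [mul_comm, Complex.mul_conj, Complex.normSq_eq_norm_sq]
    norm_cast
    have := norm_nonneg a
    nlinarith
  exact sub_eq_zero.1 ((mul_eq_zero.1 h1).resolve_left h2)

/-- The squared `L²` norm of the derivative of a Möbius self-map of the disk is the area of its
image, hence at most `1`. -/
theorem lintegral_norm_deriv_mobius_sq_le {a : ℂ} (ha : ‖a‖ < 1) :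
    ∫⁻ z, ENNReal.ofReal (‖(conj a * a - 1) / (1 - conj a * z) ^ 2‖ ^ 2) ∂areaMeasure ≤ 1 := by
  have hne : ∀ z ∈ unitDisk, 1 - conj a * z ≠ 0 := fun z hz => norm_pos_iff.1 <|
    (sub_pos.2 ha).trans_le (one_sub_norm_le_norm_one_sub (mem_unitDisk.1 hz))
  have key := lintegral_abs_det_fderiv_eq_addHaar_image volume measurableSet_unitDisk
    (fun z hz => ((hasDerivAt_mobius (hne z hz)).hasFDerivAt.restrictScalars ℝ).hasFDerivWithinAt)
    (mobius_injOn ha)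
  simp only [det_toSpanSingleton_restrictScalars, abs_pow, abs_norm] at key
  rw [areaMeasure, lintegral_smul_measure, key]
  calc _ ≤ ENNReal.ofReal (1 / Real.pi) * volume unitDisk := by
        rw [smul_eq_mul]
        gcongr
        rintro _ ⟨z, hz, rfl⟩
        exact mobius_mem_unitDisk ha (mem_unitDisk.1 hz)
    _ = 1 := by
        rw [unitDisk, Complex.volume_ball, one_div, ENNReal.ofReal_inv_of_pos Real.pi_pos]
        simp only [ENNReal.ofReal_one, one_pow, one_mul]
        rw [← ENNReal.ofReal_coe_nnreal, NNReal.coe_real_pi]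
        exact ENNReal.inv_mul_cancel (by simp [Real.pi_pos]) ENNReal.ofReal_ne_top

/-- The test function `(h / (1 - conj a z))⁴` for `|a| = 1 - h` is bounded by `1`, and by `h²` times
the squared modulus of the derivative of a Möbius map; by convexity this bounds its norm by
`1 / Ψ⁻¹(1 / h²)`. -/
theorem orliczModular_testFunction_le {Ψ : ℝ → ℝ} (hΨ : IsOrlicz Ψ) {a : ℂ} {h : ℝ} (h0 : 0 < h)
    (h1 : h < 1) (ha : ‖a‖ = 1 - h) :
    orliczModular Ψ areaMeasure (fun z => ((h : ℂ) / (1 - conj a * z)) ^ 4)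
      (orliczInv Ψ (1 / h ^ 2))⁻¹ ≤ 1 := by
  have hx := hΨ.orliczInv_spec (y := 1 / h ^ 2) (by positivity)
  refine le_trans ?_ (lintegral_norm_deriv_mobius_sq_le (a := a) (by linarith))
  unfold orliczModular
  rw [areaMeasure, lintegral_smul_measure, lintegral_smul_measure]
  refine smul_le_smul_of_nonneg_left (setLIntegral_mono' measurableSet_unitDisk fun z hz => ?_)
    zero_le
  refine ENNReal.ofReal_le_ofReal ?_
  have hz1 : h ≤ ‖1 - conj a * z‖ := by
    have := one_sub_norm_le_norm_one_sub (a := a) (mem_unitDisk.1 hz)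
    linarith
  have hpos : 0 < ‖1 - conj a * z‖ := h0.trans_le hz1
  have hfz : ‖((h : ℂ) / (1 - conj a * z)) ^ 4‖ = (h / ‖1 - conj a * z‖) ^ 4 := by
    rw [norm_pow, norm_div, Complex.norm_real, Real.norm_of_nonneg h0.le]
  have hnum : h ≤ ‖conj a * a - 1‖ := by
    have e : conj a * a - 1 = ((‖a‖ ^ 2 - 1 : ℝ) : ℂ) := by
      rw [mul_comm, Complex.mul_conj, Complex.normSq_eq_norm_sq]
      norm_cast
    rw [e, Complex.norm_real, Real.norm_eq_abs, ha, abs_of_nonpos (by nlinarith)]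
    nlinarith
  rw [div_inv_eq_mul]
  calc _ ≤ ‖((h : ℂ) / (1 - conj a * z)) ^ 4‖ * Ψ (orliczInv Ψ (1 / h ^ 2)) := by
        refine hΨ.map_mul_le (norm_nonneg _) ?_ hx.1
        rw [hfz]
        exact pow_le_one₀ (by positivity) ((div_le_one hpos).2 hz1)
    _ = (h / ‖1 - conj a * z‖ ^ 2) ^ 2 := by
        rw [hfz, hx.2]
        field_simp
    _ ≤ _ := by
        rw [norm_div, norm_pow]
        gcongr

/-- On the window `W(ξ, h)`, the test function with `a = (1 - h) ξ` is bounded below. -/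
theorem norm_one_sub_le_of_mem_carlesonWindow {ξ z : ℂ} {h : ℝ} (hξ : ‖ξ‖ = 1) (h1 : h < 1)
    (hz : z ∈ carlesonWindow ξ h) :
    ‖1 - conj (((1 - h : ℝ) : ℂ) * ξ) * z‖ ≤ (2 + Real.pi) * h := by
  obtain ⟨hz1, hz2, hz3⟩ := hz
  have hz1 := mem_unitDisk.1 hz1
  set u := z * conj ξ with hu
  have hun : ‖u‖ = ‖z‖ := by simp [hu, hξ]
  have hpolar : (‖u‖ : ℂ) * Complex.exp (u.arg * Complex.I) = u := Complex.norm_mul_exp_arg_mul_I u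
  -- The chord from `|u|` to `u` is no longer than the arc.
  have hangle : ‖u - ‖u‖‖ ≤ Real.pi * h := by
    have e : u - ‖u‖ = ‖u‖ * (Complex.exp (Complex.I * u.arg) - 1) := by
      rw [mul_comm Complex.I, mul_sub, hpolar, mul_one]
    rw [e, norm_mul, Complex.norm_real, norm_norm]
    have h2 := Real.norm_exp_I_mul_ofReal_sub_one_le (x := u.arg)
    rw [Real.norm_eq_abs] at h2
    calc ‖u‖ * _ ≤ 1 * (Real.pi * h) := by
          refine mul_le_mul (by linarith) (h2.trans hz3) (norm_nonneg _) zero_le_one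
      _ = _ := one_mul _
  have e : 1 - conj (((1 - h : ℝ) : ℂ) * ξ) * z
      = ((1 - (1 - h) * ‖u‖ : ℝ) : ℂ) - ((1 - h : ℝ) : ℂ) * (u - ‖u‖) := by
    rw [map_mul, Complex.conj_ofReal, hu]
    push_cast
    ring
  have hh : 0 ≤ h := by linarith
  rw [e]
  refine (norm_sub_le _ _).trans ?_
  rw [norm_mul ((1 - h : ℝ) : ℂ), Complex.norm_real, Complex.norm_real,
    Real.norm_of_nonneg (by linarith : 0 ≤ 1 - h),
    Real.norm_of_nonneg (by rw [hun]; nlinarith [norm_nonneg z]), hun]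
  have : (1 - h) * ‖u - ‖u‖‖ ≤ 1 * (Real.pi * h) :=
    mul_le_mul (by linarith) hangle (norm_nonneg _) zero_le_one
  rw [hun] at this
  nlinarith

/-- Necessity: apply the bound to the test function with `a = (1 - h) ξ` and compare the modular of
`Ψ₂` with its part over the window. -/
theorem exists_carlesonRho_le_of_embeddingBounded {μ : Measure ℂ} {Ψ₁ Ψ₂ : ℝ → ℝ}
    (hΨ₁ : IsOrlicz Ψ₁) (hΨ₂ : IsOrlicz Ψ₂) (hb : EmbeddingBounded Ψ₁ Ψ₂ μ) :
    ∃ A : ℝ, 0 < A ∧ ∀ h : ℝ, 0 < h → h < 1 →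
      carlesonRho μ h ≤ 1 / ENNReal.ofReal (Ψ₂ (A * orliczInv Ψ₁ (1 / h ^ 2))) := by
  obtain ⟨M, hM⟩ := hb
  -- `δ` bounds the test functions from below on the windows.
  set δ : ℝ := (1 / (2 + Real.pi)) ^ 4 with hδ
  have hδ0 : 0 < δ := by have := Real.pi_pos; positivity
  set N : ℝ := max M 1 + 1 with hN
  have hN0 : 0 < N := by linarith [le_max_right M 1]
  refine ⟨δ / N, by positivity, fun h h0 h1 => iSup₂_le fun ξ hξ => ?_⟩
  have hx := hΨ₁.orliczInv_pos (y := 1 / h ^ 2) (by positivity)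
  set x := orliczInv Ψ₁ (1 / h ^ 2) with hxdef
  set a : ℂ := ((1 - h : ℝ) : ℂ) * ξ with ha
  have han : ‖a‖ = 1 - h := by
    rw [ha, norm_mul, hξ, mul_one, Complex.norm_real, Real.norm_of_nonneg (by linarith)]
  set f : ℂ → ℂ := fun z => ((h : ℂ) / (1 - conj a * z)) ^ 4 with hf
  have hmod : orliczModular Ψ₁ areaMeasure f x⁻¹ ≤ 1 :=
    orliczModular_testFunction_le hΨ₁ h0 h1 han
  have hfm : Measurable f := by fun_prop
  have hmem : MemBergmanOrlicz Ψ₁ f := by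
    refine ⟨fun z hz => ?_, hfm.aestronglyMeasurable, x⁻¹, by positivity,
      hmod.trans_lt ENNReal.one_lt_top⟩
    have hne : 1 - conj a * z ≠ 0 := norm_pos_iff.1 <| lt_of_lt_of_le (by linarith)
      (one_sub_norm_le_norm_one_sub (a := a) (mem_unitDisk.1 hz))
    refine DifferentiableAt.differentiableWithinAt ?_
    fun_prop (disch := exact hne)
  obtain ⟨hmem₂, hle⟩ := hM f hmem
  have hnorm₁ : orliczNorm Ψ₁ areaMeasure f ≤ x⁻¹ := orliczNorm_le (by positivity) hmod
  have hnorm₂ : orliczNorm Ψ₂ μ f < N * x⁻¹ := by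
    calc _ ≤ M * orliczNorm Ψ₁ areaMeasure f := hle
      _ ≤ max M 1 * x⁻¹ := mul_le_mul (le_max_left _ _) hnorm₁ (orliczNorm_nonneg _ _ _)
          (zero_le_one.trans (le_max_right _ _))
      _ < N * x⁻¹ := by
          have : 0 < x⁻¹ := by positivity
          rw [hN]
          nlinarith
  have hmod₂ := orliczModular_le_one_of_norm_lt hΨ₂ hmem₂ hnorm₂
  rw [ENNReal.le_div_iff_mul_le (Or.inr one_ne_zero) (Or.inr ENNReal.one_ne_top), mul_comm]
  refine le_trans ?_ hmod₂
  refine le_trans (mul_le_mul_right (measure_mono fun z hz => ?_) _)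
    (mul_meas_ge_le_lintegral₀ ?_ _)
  · refine ENNReal.ofReal_le_ofReal (hΨ₂.mono (by positivity) ?_)
    have hz1 : h ≤ ‖1 - conj a * z‖ := by
      have := one_sub_norm_le_norm_one_sub (a := a) (mem_unitDisk.1 hz.1)
      linarith
    have hz2 := norm_one_sub_le_of_mem_carlesonWindow hξ h1 hz
    have hfz : ‖f z‖ = (h / ‖1 - conj a * z‖) ^ 4 := by
      rw [hf, norm_pow, norm_div, Complex.norm_real, Real.norm_of_nonneg h0.le]
    have hlow : δ ≤ ‖f z‖ := by
      have := Real.pi_pos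
      have hpos : 0 < ‖1 - conj a * z‖ := by linarith
      rw [hδ, hfz]
      refine pow_le_pow_left₀ (by positivity) ?_ 4
      rw [div_le_div_iff₀ (by positivity) hpos]
      linarith
    calc δ / N * x = δ / (N * x⁻¹) := by field_simp
      _ ≤ _ := by gcongr
  · have hm := (hΨ₂.continuous_norm_div (C := N * x⁻¹) (by positivity)).measurable.comp hfm
    exact hm.ennreal_ofReal.aemeasurable

/-! ### The sub-mean value property -/

/-- Jensen's inequality for the convex function `Ψ ∘ |·|`, applied to the mean value property of `f`
on a circle. -/
theorem IsOrlicz.map_norm_le_lintegral_circle {Ψ : ℝ → ℝ} (h : IsOrlicz Ψ) {f : ℂ → ℂ} {z : ℂ}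
    {r : ℝ} (hr : 0 < r) (hf : DiffContOnCl ℂ f (Metric.ball z r)) :
    ENNReal.ofReal (2 * Real.pi * Ψ ‖f z‖) ≤
      ∫⁻ θ in Ioo (-Real.pi) Real.pi, ENNReal.ofReal (Ψ ‖f (circleMap z r θ)‖) := by
  have hπ := Real.pi_pos
  set F : ℝ → ℂ := fun θ => f (circleMap z r θ) with hF
  have hFc : Continuous F := by
    refine hf.continuousOn.comp_continuous (continuous_circleMap z r) fun θ => ?_
    rw [closure_ball z hr.ne']
    exact circleMap_mem_closedBall z hr.le θ
  have hint : ∀ g : ℝ → ℂ, Continuous g → IntegrableOn g (Ioo (-Real.pi) Real.pi) := fun g hg =>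
    (hg.continuousOn.integrableOn_Icc).mono_set Ioo_subset_Icc_self
  have hvol : volume.real (Ioo (-Real.pi) Real.pi) = 2 * Real.pi := by
    rw [Real.volume_real_Ioo_of_le (by linarith)]
    ring
  have hmean : ⨍ θ in Ioo (-Real.pi) Real.pi, F θ = f z := by
    have hper : Function.Periodic F (2 * Real.pi) := fun θ => by
      simp only [hF, periodic_circleMap z r θ]
    have h1 := hper.intervalIntegral_add_eq 0 (-Real.pi)
    rw [zero_add, show -Real.pi + 2 * Real.pi = Real.pi by ring,
      intervalIntegral.integral_of_le (a := -Real.pi) (by linarith),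
      integral_Ioc_eq_integral_Ioo] at h1
    rw [setAverage_eq, hvol, ← h1]
    have h2 := DiffContOnCl.circleAverage (f := f) (c := z) (R := r) (by rwa [abs_of_pos hr])
    exact h2
  have hg : Continuous fun θ => Ψ ‖F θ‖ := h.continuous_norm.comp hFc
  have hgi : IntegrableOn (fun θ => Ψ ‖F θ‖) (Ioo (-Real.pi) Real.pi) :=
    (hg.continuousOn.integrableOn_Icc).mono_set Ioo_subset_Icc_self
  have hJ := h.convexOn_norm.map_set_average_le (μ := volume) (t := Ioo (-Real.pi) Real.pi)
    (f := F) h.continuous_norm.continuousOn isClosed_univ (by simp [hπ]) (by simp)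
    (by simp) (hint F hFc) hgi
  rw [hmean, setAverage_eq, hvol, smul_eq_mul, le_inv_mul_iff₀ (by positivity)] at hJ
  rw [← ofReal_integral_eq_lintegral_ofReal hgi (ae_of_all _ fun θ => h.nonneg (norm_nonneg _))]
  exact ENNReal.ofReal_le_ofReal hJ

/-- `Ψ ∘ |f|` is subharmonic when `f` is analytic: its value at the centre of a disk is at most its
area mean. -/
theorem IsOrlicz.map_norm_le_lintegral_ball {Ψ : ℝ → ℝ} (h : IsOrlicz Ψ) {f : ℂ → ℂ}
    (hfm : Measurable f) {z : ℂ} {r : ℝ} (hr : 0 < r)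
    (hf : DifferentiableOn ℂ f (Metric.ball z r)) :
    ENNReal.ofReal (Real.pi * r ^ 2 * Ψ ‖f z‖) ≤
      ∫⁻ w in Metric.ball z r, ENNReal.ofReal (Ψ ‖f w‖) := by
  have hπ := Real.pi_pos
  have hΨf : 0 ≤ Ψ ‖f z‖ := h.nonneg (norm_nonneg _)
  set G : ℂ → ℝ≥0∞ := (Metric.ball z r).indicator fun w => ENNReal.ofReal (Ψ ‖f w‖) with hG
  have hGm : Measurable G :=
    ((h.continuous_norm.measurable.comp hfm).ennreal_ofReal).indicator
      Metric.isOpen_ball.measurableSet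
  have hsymm : ∀ ρ θ : ℝ, z + Complex.polarCoord.symm (ρ, θ) = circleMap z ρ θ := fun ρ θ => by
    rw [Complex.polarCoord_symm_apply, circleMap, Complex.exp_mul_I]
    simp
  have hmeas : Measurable fun p : ℝ × ℝ =>
      ENNReal.ofReal p.1 * G (circleMap z p.1 p.2) :=
    (measurable_fst.ennreal_ofReal).mul (hGm.comp (f := fun p : ℝ × ℝ => circleMap z p.1 p.2)
      (by unfold circleMap; fun_prop))
  have hpolar : ∫⁻ w in Metric.ball z r, ENNReal.ofReal (Ψ ‖f w‖)
      = ∫⁻ ρ in Ioi (0 : ℝ), ∫⁻ θ in Ioo (-Real.pi) Real.pi,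
          ENNReal.ofReal ρ * G (circleMap z ρ θ) := by
    rw [← lintegral_indicator Metric.isOpen_ball.measurableSet, ← hG,
      ← lintegral_add_left_eq_self G z, ← Complex.lintegral_comp_polarCoord_symm,
      polarCoord_target, Measure.volume_eq_prod, ← Measure.prod_restrict]
    simp only [smul_eq_mul]
    rw [← lintegral_prod _ hmeas.aemeasurable]
    refine lintegral_congr fun p => ?_
    rw [← hsymm]
  rw [hpolar]
  calc ENNReal.ofReal (Real.pi * r ^ 2 * Ψ ‖f z‖)
      = ∫⁻ ρ in Ioo 0 r, ENNReal.ofReal (ρ * (2 * Real.pi * Ψ ‖f z‖)) := by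
        rw [← ofReal_integral_eq_lintegral_ofReal]
        · congr 1
          rw [← integral_Ioc_eq_integral_Ioo, ← intervalIntegral.integral_of_le hr.le,
            intervalIntegral.integral_mul_const, integral_id]
          ring
        · exact ((by fun_prop : Continuous fun ρ : ℝ =>
            ρ * (2 * Real.pi * Ψ ‖f z‖)).continuousOn.integrableOn_Icc).mono_set Ioo_subset_Icc_self
        · filter_upwards [ae_restrict_mem measurableSet_Ioo] with ρ hρ
          have := hρ.1.le
          simp only [Pi.zero_apply]
          positivity
    _ ≤ ∫⁻ ρ in Ioo 0 r, ∫⁻ θ in Ioo (-Real.pi) Real.pi,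
          ENNReal.ofReal ρ * G (circleMap z ρ θ) := by
        refine setLIntegral_mono' measurableSet_Ioo fun ρ hρ => ?_
        rw [lintegral_const_mul' _ _ ENNReal.ofReal_ne_top, ENNReal.ofReal_mul hρ.1.le]
        refine mul_le_mul_right (le_trans (h.map_norm_le_lintegral_circle hρ.1 ?_)
          (lintegral_mono fun θ => ?_)) _
        · refine DifferentiableOn.diffContOnCl (hf.mono ?_)
          rw [closure_ball z hρ.1.ne']
          exact Metric.closedBall_subset_ball hρ.2
        · rw [hG, indicator_of_mem]
          exact Metric.closedBall_subset_ball hρ.2 (circleMap_mem_closedBall z hρ.1.le θ)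
    _ ≤ _ := lintegral_mono_set Ioo_subset_Ioi_self

/-- The sub-mean value property in the normalized area, for which a disk of radius `r` has measure
`r²`. -/
theorem IsOrlicz.map_norm_le_lintegral_ball_areaMeasure {Ψ : ℝ → ℝ} (h : IsOrlicz Ψ) {f : ℂ → ℂ}
    (hfm : Measurable f) (hf : DifferentiableOn ℂ f unitDisk) {z : ℂ} {r : ℝ} (hr : 0 < r)
    (hz : Metric.ball z r ⊆ unitDisk) :
    ENNReal.ofReal (r ^ 2 * Ψ ‖f z‖) ≤
      ∫⁻ w in Metric.ball z r, ENNReal.ofReal (Ψ ‖f w‖) ∂areaMeasure := by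
  have hπ := Real.pi_pos
  rw [areaMeasure, Measure.restrict_smul,
    Measure.restrict_restrict Metric.isOpen_ball.measurableSet,
    inter_eq_self_of_subset_left hz, lintegral_smul_measure, smul_eq_mul]
  calc ENNReal.ofReal (r ^ 2 * Ψ ‖f z‖)
      = ENNReal.ofReal (1 / Real.pi) * ENNReal.ofReal (Real.pi * r ^ 2 * Ψ ‖f z‖) := by
        rw [← ENNReal.ofReal_mul (by positivity)]
        congr 1
        field_simp
    _ ≤ _ := by
        gcongr
        exact h.map_norm_le_lintegral_ball hfm hr (hf.mono hz)

/-! ### Sufficiency: integration over hyperbolic disks -/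

/-- The points `z` whose disk of radius half the distance to the circle contains `w` lie in a
Carleson window of size comparable to `1 - |w|`. -/
theorem mem_carlesonWindow_of_norm_sub_lt {w z ξ : ℂ} (hξ : ‖ξ‖ = 1) (hwξ : w = ‖w‖ * ξ)
    (hz : ‖z‖ < 1) (hzw : ‖w - z‖ < (1 - ‖z‖) / 2) :
    z ∈ carlesonWindow ξ (4 * (1 - ‖w‖)) := by
  have hπ := Real.pi_pos
  have h1 : |‖w‖ - ‖z‖| ≤ ‖w - z‖ := abs_norm_sub_norm_le w z
  rw [abs_le] at h1
  refine ⟨mem_unitDisk.2 hz, by linarith [norm_nonneg z], ?_⟩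
  -- A window of size at least `1` imposes no condition on the argument.
  rcases le_or_gt 1 (4 * (1 - ‖w‖)) with hd | hd
  · exact (Complex.abs_arg_le_pi _).trans (by nlinarith)
  set u := z * conj ξ with hu
  have hξξ : ξ * conj ξ = 1 := by rw [Complex.mul_conj, Complex.normSq_eq_norm_sq, hξ]; simp
  have huw : ‖u - ‖w‖‖ < 1 - ‖w‖ := by
    have e : u - ‖w‖ = (z - w) * conj ξ := by
      rw [sub_mul, ← hu]
      nth_rw 2 [hwξ]
      rw [mul_assoc, hξξ, mul_one]
    rw [e, norm_mul, RCLike.norm_conj, hξ, mul_one, norm_sub_rev]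
    linarith
  have hre : 1 / 2 < u.re := by
    have := (Complex.abs_re_le_norm (u - ‖w‖)).trans_lt huw
    rw [Complex.sub_re, Complex.ofReal_re, abs_lt] at this
    linarith
  have him : |u.im| < 1 - ‖w‖ := by
    have := (Complex.abs_im_le_norm (u - ‖w‖)).trans_lt huw
    rwa [Complex.sub_im, Complex.ofReal_im, sub_zero] at this
  have hnu : 1 / 2 < ‖u‖ := hre.trans_le (Complex.re_le_norm u)
  have harg := Real.mul_abs_le_abs_sin
    (Complex.abs_arg_le_pi_div_two_iff.2 (by linarith : 0 ≤ u.re))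
  rw [Complex.sin_arg, abs_div, abs_norm] at harg
  have h2 : |u.im| / ‖u‖ ≤ 2 * (1 - ‖w‖) := by
    rw [div_le_iff₀ (by linarith)]
    nlinarith
  have h3 : 2 / Real.pi * |u.arg| ≤ 2 * (1 - ‖w‖) := harg.trans h2
  rw [div_mul_eq_mul_div, div_le_iff₀ hπ] at h3
  nlinarith

/-- The hypothesis on `K`, read at the scale `H` with `1 / H² = Ψ₁(s) / 256`. -/
theorem carlesonRho_mul_le {μ : Measure ℂ} {Ψ₁ Ψ₂ : ℝ → ℝ} (hΨ₁ : IsOrlicz Ψ₁)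
    (hΨ₂ : IsOrlicz Ψ₂) {A : ℝ} (hA : 0 < A)
    (hK : ∀ h : ℝ, 0 < h → h < 1 → carlesonK μ h ≤
      ENNReal.ofReal (1 / h ^ 2) / ENNReal.ofReal (Ψ₂ (A * orliczInv Ψ₁ (1 / h ^ 2))))
    {s t : ℝ} (hs : 0 ≤ s) (hs1 : 256 < Ψ₁ s) (ht : 0 < t) (hts : t ^ 2 * Ψ₁ s < 256) :
    carlesonRho μ t * ENNReal.ofReal (Ψ₂ (s / (256 / A))) ≤
      ENNReal.ofReal (t ^ 2 * (Ψ₁ s / 256)) := by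
  have hΨs : 0 < Ψ₁ s := by linarith
  set H := Real.sqrt (256 / Ψ₁ s) with hH
  have hH2 : 1 / H ^ 2 = Ψ₁ s / 256 := by
    rw [hH, Real.sq_sqrt (by positivity), one_div_div]
  have hH0 : 0 < H := Real.sqrt_pos.2 (by positivity)
  have hH1 : H < 1 := by
    rw [hH, Real.sqrt_lt' one_pos, one_pow, div_lt_one hΨs]
    exact hs1
  have htH : t < H := by
    rw [hH, Real.lt_sqrt ht.le, lt_div_iff₀ hΨs]
    exact hts
  have hKH := hK H hH0 hH1
  rw [hH2] at hKH
  set b := ENNReal.ofReal (Ψ₂ (A * orliczInv Ψ₁ (Ψ₁ s / 256))) with hb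
  have hsb : ENNReal.ofReal (Ψ₂ (s / (256 / A))) ≤ b := by
    refine ENNReal.ofReal_le_ofReal (hΨ₂.mono (by positivity) ?_)
    have h1 := hΨ₁.map_mul_le (c := 1 / 256) (by norm_num) (by norm_num) hs
    have h2 : 1 / 256 * s ≤ orliczInv Ψ₁ (Ψ₁ s / 256) :=
      hΨ₁.le_orliczInv (by positivity) (by positivity) (h1.trans_eq (by ring))
    calc s / (256 / A) = A * (1 / 256 * s) := by field_simp
      _ ≤ _ := by gcongr
  have hρ : carlesonRho μ t ≤ ENNReal.ofReal (Ψ₁ s / 256) / b * ENNReal.ofReal (t ^ 2) := by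
    have h1 : carlesonRho μ t / ENNReal.ofReal (t ^ 2) ≤ carlesonK μ H :=
      le_iSup₂ (f := fun (t : ℝ) (_ : t ∈ Ioo 0 H) => carlesonRho μ t / ENNReal.ofReal (t ^ 2))
        t ⟨ht, htH⟩
    refine (ENNReal.div_le_iff_le_mul (Or.inl ?_) (Or.inl ENNReal.ofReal_ne_top)).1 (h1.trans hKH)
    exact (ENNReal.ofReal_pos.2 (by positivity)).ne'
  calc _ ≤ ENNReal.ofReal (Ψ₁ s / 256) / b * ENNReal.ofReal (t ^ 2) * b := mul_le_mul' hρ hsb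
    _ = ENNReal.ofReal (t ^ 2) * (b * (ENNReal.ofReal (Ψ₁ s / 256) / b)) := by ring
    _ ≤ ENNReal.ofReal (t ^ 2) * ENNReal.ofReal (Ψ₁ s / 256) := by
        gcongr
        exact ENNReal.mul_div_le
    _ = _ := (ENNReal.ofReal_mul (by positivity)).symm

/-- A form of `∫ g ≤ (sup g) μ(S)` that avoids dividing by `μ(S)`, which may vanish. -/
theorem setLIntegral_le_of_forall_mul_measure_le {α : Type*} [MeasurableSpace α] {μ : Measure α}
    [IsFiniteMeasure μ] {S : Set α} (hS : MeasurableSet S) {g : α → ℝ≥0∞} {c : ℝ≥0∞}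
    (h : ∀ x ∈ S, g x * μ S ≤ c) : ∫⁻ x in S, g x ∂μ ≤ c := by
  rcases eq_or_ne (μ S) 0 with h0 | h0
  · rw [setLIntegral_measure_zero _ _ h0]
    exact zero_le
  calc ∫⁻ x in S, g x ∂μ ≤ ∫⁻ _ in S, c / μ S ∂μ :=
        setLIntegral_mono' hS fun x hx =>
          (ENNReal.le_div_iff_mul_le (Or.inl h0) (Or.inl (measure_ne_top μ S))).2 (h x hx)
    _ = c / μ S * μ S := setLIntegral_const _ _
    _ ≤ c := by rw [mul_comm]; exact ENNReal.mul_div_le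

instance : SFinite areaMeasure := by unfold areaMeasure; infer_instance

theorem exists_norm_eq_one_eq_norm_mul (w : ℂ) : ∃ ξ : ℂ, ‖ξ‖ = 1 ∧ w = ‖w‖ * ξ :=
  ⟨Complex.exp (w.arg * Complex.I), Complex.norm_exp_ofReal_mul_I _,
    (Complex.norm_mul_exp_arg_mul_I w).symm⟩

/-- The heart of the sufficiency: on the set where `Ψ₁(|f|)` is large, `Ψ₂(|f| / C)` is dominated by
a weighted mean of `Ψ₁(|f|)` over the disk of radius `(1 - |z|) / 2`. After exchanging the order of
integration, the weight seen from each point `w` is controlled by the measure of one Carleson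
window at `w`. -/
theorem setLIntegral_map_norm_div_le_one {μ : Measure ℂ} [IsFiniteMeasure μ] {Ψ₁ Ψ₂ : ℝ → ℝ}
    (hΨ₁ : IsOrlicz Ψ₁) (hΨ₂ : IsOrlicz Ψ₂) {A : ℝ} (hA : 0 < A)
    (hK : ∀ h : ℝ, 0 < h → h < 1 → carlesonK μ h ≤
      ENNReal.ofReal (1 / h ^ 2) / ENNReal.ofReal (Ψ₂ (A * orliczInv Ψ₁ (1 / h ^ 2))))
    {f : ℂ → ℂ} (hfm : Measurable f) (hf : DifferentiableOn ℂ f unitDisk)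
    (hmod : ∫⁻ z, ENNReal.ofReal (Ψ₁ ‖f z‖) ∂areaMeasure ≤ 1) :
    ∫⁻ z in {z ∈ unitDisk | 256 < Ψ₁ ‖f z‖}, ENNReal.ofReal (Ψ₂ (‖f z‖ / (256 / A))) ∂μ ≤ 1 := by
  set E : Set ℂ := {z ∈ unitDisk | 256 < Ψ₁ ‖f z‖} with hE
  set F : ℂ → ℝ≥0∞ := fun w => ENNReal.ofReal (Ψ₁ ‖f w‖) with hF
  set g : ℂ → ℝ≥0∞ := fun z => ENNReal.ofReal (Ψ₂ (‖f z‖ / (256 / A)) / Ψ₁ ‖f z‖) with hg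
  set P : Set (ℂ × ℂ) := {p | ‖p.2 - p.1‖ < (1 - ‖p.1‖) / 2} with hP
  set Φ : ℂ × ℂ → ℝ≥0∞ :=
    P.indicator fun p => g p.1 * ENNReal.ofReal (4 / (1 - ‖p.1‖) ^ 2) * F p.2 with hΦ
  have hm₁ : Measurable fun z => Ψ₁ ‖f z‖ := hΨ₁.continuous_norm.measurable.comp hfm
  have hm₂ : Measurable fun z => Ψ₂ (‖f z‖ / (256 / A)) :=
    (hΨ₂.continuous_norm_div (by positivity)).measurable.comp hfm
  have hEm : MeasurableSet E := measurableSet_unitDisk.inter (measurableSet_lt measurable_const hm₁)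
  have hFm : Measurable F := hm₁.ennreal_ofReal
  have hgm : Measurable g := (hm₂.div hm₁).ennreal_ofReal
  have hPm : MeasurableSet P := measurableSet_lt (by fun_prop) (by fun_prop)
  have hΦm : Measurable Φ := by
    refine Measurable.indicator ?_ hPm
    refine ((hgm.comp measurable_fst).mul ?_).mul (hFm.comp measurable_snd)
    exact Measurable.ennreal_ofReal (by fun_prop)
  -- The disk of radius `(1 - |z|) / 2` about `z` stays inside the unit disk.
  have hball : ∀ z ∈ unitDisk, ENNReal.ofReal (((1 - ‖z‖) / 2) ^ 2 * Ψ₁ ‖f z‖) ≤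
      ∫⁻ w in Metric.ball z ((1 - ‖z‖) / 2), F w ∂areaMeasure := fun z hz => by
    have hz1 := mem_unitDisk.1 hz
    refine hΨ₁.map_norm_le_lintegral_ball_areaMeasure hfm hf (by linarith) fun w hw => ?_
    rw [mem_ball_iff_norm] at hw
    rw [mem_unitDisk]
    linarith [norm_sub_norm_le w z]
  have hgrowth : ∀ z ∈ unitDisk, ((1 - ‖z‖) / 2) ^ 2 * Ψ₁ ‖f z‖ ≤ 1 := fun z hz =>
    ENNReal.ofReal_le_one.1 ((hball z hz).trans ((setLIntegral_le_lintegral _ _).trans hmod))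
  have hpoint : ∀ z ∈ E, ENNReal.ofReal (Ψ₂ (‖f z‖ / (256 / A))) ≤
      ∫⁻ w, Φ (z, w) ∂areaMeasure := by
    intro z hz
    have hz1 := mem_unitDisk.1 hz.1
    have hΨs : 0 < Ψ₁ ‖f z‖ := by linarith [hz.2]
    have hδ : 0 < 1 - ‖z‖ := by linarith
    have e : (fun w => Φ (z, w)) = (Metric.ball z ((1 - ‖z‖) / 2)).indicator
        fun w => g z * ENNReal.ofReal (4 / (1 - ‖z‖) ^ 2) * F w := by
      ext w
      simp only [hΦ, hP, indicator, mem_ofPred_eq, mem_ball_iff_norm]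
    rw [e, lintegral_indicator Metric.isOpen_ball.measurableSet, lintegral_const_mul _ hFm]
    refine le_trans (le_of_eq ?_) (mul_le_mul_right (hball z hz.1) _)
    have hΨ₂n : 0 ≤ Ψ₂ (‖f z‖ / (256 / A)) := hΨ₂.nonneg (by positivity)
    rw [hg, ← ENNReal.ofReal_mul (by positivity), ← ENNReal.ofReal_mul (by positivity)]
    congr 1
    field_simp
    norm_num
  have hinner : ∀ w ∈ unitDisk, ∫⁻ z in E, Φ (z, w) ∂μ ≤ F w := by
    intro w hw
    have hw1 := mem_unitDisk.1 hw
    set d := 1 - ‖w‖ with hd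
    have hd0 : 0 < d := by linarith
    set N : Set ℂ := {z | ‖w - z‖ < (1 - ‖z‖) / 2} with hN
    have hNm : MeasurableSet N := measurableSet_lt (by fun_prop) (by fun_prop)
    have hcomp : ∀ z ∈ N, 2 * d ≤ 3 * (1 - ‖z‖) := fun z hz => by
      have h1 : ‖w - z‖ < (1 - ‖z‖) / 2 := hz
      have h2 := norm_sub_norm_le z w
      rw [norm_sub_rev] at h2
      linarith
    obtain ⟨ξ, hξ, hwξ⟩ := exists_norm_eq_one_eq_norm_mul w
    have hS : ∫⁻ z in N ∩ E, g z ∂μ ≤ ENNReal.ofReal (d ^ 2 / 16) := by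
      refine setLIntegral_le_of_forall_mul_measure_le (hNm.inter hEm) fun z hz => ?_
      have hΨs : 0 < Ψ₁ ‖f z‖ := by linarith [hz.2.2]
      have hμ : μ (N ∩ E) ≤ carlesonRho μ (4 * d) := by
        refine le_trans (measure_mono fun x hx => ?_)
          (le_iSup₂ (f := fun (ξ : ℂ) (_ : ‖ξ‖ = 1) => μ (carlesonWindow ξ (4 * d))) ξ hξ)
        exact mem_carlesonWindow_of_norm_sub_lt hξ hwξ (mem_unitDisk.1 hx.2.1) hx.1
      -- The window has size `4 d ≤ 6 (1 - |z|)`, so the product is at most `36 * 4 = 144`; the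
      -- threshold `256` leaves the strict inequality needed in the supremum defining `K`.
      have ht : (4 * d) ^ 2 * Ψ₁ ‖f z‖ < 256 := by
        have h1 := hgrowth z hz.2.1
        have h2 : (4 * d) ^ 2 ≤ 144 * ((1 - ‖z‖) / 2) ^ 2 := by
          have := pow_le_pow_left₀ (by positivity) (hcomp z hz.1) 2
          linarith
        nlinarith [mul_le_mul_of_nonneg_right h2 hΨs.le]
      have hρ := carlesonRho_mul_le hΨ₁ hΨ₂ hA hK (norm_nonneg (f z)) hz.2.2
        (by positivity : 0 < 4 * d) ht
      have hΨ₂n : 0 ≤ Ψ₂ (‖f z‖ / (256 / A)) := hΨ₂.nonneg (by positivity)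
      calc g z * μ (N ∩ E) ≤ g z * carlesonRho μ (4 * d) := by gcongr
        _ = ENNReal.ofReal (Ψ₁ ‖f z‖)⁻¹ *
            (carlesonRho μ (4 * d) * ENNReal.ofReal (Ψ₂ (‖f z‖ / (256 / A)))) := by
          simp only [hg]
          rw [div_eq_mul_inv, ENNReal.ofReal_mul hΨ₂n]
          ring
        _ ≤ ENNReal.ofReal (Ψ₁ ‖f z‖)⁻¹ * ENNReal.ofReal ((4 * d) ^ 2 * (Ψ₁ ‖f z‖ / 256)) := by
          gcongr
        _ = ENNReal.ofReal (d ^ 2 / 16) := by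
          rw [← ENNReal.ofReal_mul (by positivity)]
          congr 1
          field_simp
          norm_num
    calc ∫⁻ z in E, Φ (z, w) ∂μ
        ≤ ∫⁻ z in E, ENNReal.ofReal (9 / d ^ 2) * F w * N.indicator g z ∂μ := by
          refine setLIntegral_mono' hEm fun z hz => ?_
          by_cases hzN : z ∈ N
          · have hzP : (z, w) ∈ P := hzN
            have hδ : 0 < 1 - ‖z‖ := by linarith [mem_unitDisk.1 hz.1]
            rw [hΦ, indicator_of_mem hzP, indicator_of_mem hzN]
            calc g z * ENNReal.ofReal (4 / (1 - ‖z‖) ^ 2) * F w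
                ≤ g z * ENNReal.ofReal (9 / d ^ 2) * F w := by
                  gcongr g z * ENNReal.ofReal ?_ * F w
                  rw [div_le_div_iff₀ (by positivity) (by positivity)]
                  have := pow_le_pow_left₀ (by positivity) (hcomp z hzN) 2
                  linarith
              _ = _ := by ring
          · have hzP : (z, w) ∉ P := hzN
            rw [hΦ, indicator_of_notMem hzP]
            exact zero_le
      _ = ENNReal.ofReal (9 / d ^ 2) * F w * ∫⁻ z in N ∩ E, g z ∂μ := by
          rw [lintegral_const_mul _ (hgm.indicator hNm), lintegral_indicator hNm,
            Measure.restrict_restrict hNm]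
      _ ≤ ENNReal.ofReal (9 / d ^ 2) * F w * ENNReal.ofReal (d ^ 2 / 16) := by gcongr
      _ = ENNReal.ofReal (9 / 16) * F w := by
          rw [mul_right_comm, ← ENNReal.ofReal_mul (by positivity)]
          congr 2
          field_simp
      _ ≤ 1 * F w := by
          gcongr
          exact ENNReal.ofReal_le_one.2 (by norm_num)
      _ = F w := one_mul _
  calc _ ≤ ∫⁻ z in E, ∫⁻ w, Φ (z, w) ∂areaMeasure ∂μ := setLIntegral_mono' hEm hpoint
    _ = ∫⁻ w, ∫⁻ z in E, Φ (z, w) ∂μ ∂areaMeasure :=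
        lintegral_lintegral_swap (f := fun z w => Φ (z, w)) hΦm.aemeasurable
    _ ≤ ∫⁻ w, F w ∂areaMeasure := by
        refine lintegral_mono_ae (Measure.ae_smul_measure ?_ _)
        filter_upwards [ae_restrict_mem measurableSet_unitDisk] with w hw using hinner w hw
    _ ≤ 1 := hmod

/-- Sufficiency: a unit bound on the modular of `Ψ₁` gives a bound on the modular of `Ψ₂`, which
convexity turns into a unit bound at a larger scale. -/
theorem embeddingBounded_of_carlesonK_le {μ : Measure ℂ} [IsFiniteMeasure μ]
    (hμ : μ unitDiskᶜ = 0) {Ψ₁ Ψ₂ : ℝ → ℝ} (hΨ₁ : IsOrlicz Ψ₁) (hΨ₂ : IsOrlicz Ψ₂) {A : ℝ}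
    (hA : 0 < A)
    (hK : ∀ h : ℝ, 0 < h → h < 1 → carlesonK μ h ≤
      ENNReal.ofReal (1 / h ^ 2) / ENNReal.ofReal (Ψ₂ (A * orliczInv Ψ₁ (1 / h ^ 2)))) :
    EmbeddingBounded Ψ₁ Ψ₂ μ := by
  have hμD : ∀ᵐ z ∂μ, z ∈ unitDisk := mem_ae_iff.2 hμ
  -- `B` bounds the contribution of the set where `Ψ₁(|f|) ≤ 256`.
  set s₀ := orliczInv Ψ₁ 256 with hs₀
  set B : ℝ := Ψ₂ (s₀ / (256 / A)) * μ.real univ with hB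
  have hs₀n : 0 ≤ s₀ := (hΨ₁.orliczInv_spec (by norm_num)).1
  have hBn : 0 ≤ B := mul_nonneg (hΨ₂.nonneg (by positivity)) measureReal_nonneg
  set M : ℝ := (1 + B) * (256 / A) with hM
  have hM0 : 0 < M := by positivity
  have hunit : ∀ f : ℂ → ℂ, DifferentiableOn ℂ f unitDisk → ∀ C : ℝ, 0 < C →
      orliczModular Ψ₁ areaMeasure f C ≤ 1 → orliczModular Ψ₂ μ f (M * C) ≤ 1 := by
    intro f hf C hC hmod
    -- The values of `f` off the disk are irrelevant, so they may be taken to vanish.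
    set F : ℂ → ℂ := unitDisk.indicator fun z => f z / C with hF
    have hFD : EqOn F (fun z => f z / C) unitDisk := fun z hz => indicator_of_mem hz _
    have hFd : DifferentiableOn ℂ F unitDisk := (hf.div_const _).congr hFD
    have hFm : Measurable F :=
      measurable_of_restrict_of_restrict_compl measurableSet_unitDisk
        hFd.continuousOn.domRestrict.measurable (by
          have h0 : unitDiskᶜ.domRestrict F = fun _ => 0 :=
            funext fun z => by
              rw [domRestrict_apply, hF]
              exact indicator_of_notMem z.2 _
          rw [h0]
          exact measurable_const)
    have hFn : ∀ z ∈ unitDisk, ‖F z‖ = ‖f z‖ / C := fun z hz => by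
      rw [hFD hz, norm_div, Complex.norm_real, Real.norm_of_nonneg hC.le]
    have hFmod : ∫⁻ z, ENNReal.ofReal (Ψ₁ ‖F z‖) ∂areaMeasure ≤ 1 := by
      refine le_of_eq_of_le (lintegral_congr_ae (Measure.ae_smul_measure ?_ _)) hmod
      filter_upwards [ae_restrict_mem measurableSet_unitDisk] with z hz
      rw [hFn z hz]
    set E : Set ℂ := {z ∈ unitDisk | 256 < Ψ₁ ‖F z‖} with hE
    have hEm : MeasurableSet E := measurableSet_unitDisk.inter
      (measurableSet_lt measurable_const (hΨ₁.continuous_norm.measurable.comp hFm))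
    have hlarge := setLIntegral_map_norm_div_le_one hΨ₁ hΨ₂ hA hK hFm hFd hFmod
    have hsmall : ∫⁻ z in Eᶜ, ENNReal.ofReal (Ψ₂ (‖F z‖ / (256 / A))) ∂μ ≤ ENNReal.ofReal B := by
      calc _ ≤ ∫⁻ _ in Eᶜ, ENNReal.ofReal (Ψ₂ (s₀ / (256 / A))) ∂μ := by
            refine lintegral_mono_ae ?_
            filter_upwards [ae_restrict_mem hEm.compl, ae_restrict_of_ae hμD] with z hz hzD
            have h256 : Ψ₁ ‖F z‖ ≤ 256 := not_lt.1 fun hlt => hz ⟨hzD, hlt⟩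
            refine ENNReal.ofReal_le_ofReal (hΨ₂.mono (by positivity) ?_)
            gcongr
            exact hΨ₁.le_orliczInv (norm_nonneg _) (by norm_num) h256
        _ ≤ ENNReal.ofReal (Ψ₂ (s₀ / (256 / A))) * μ univ := by
            rw [setLIntegral_const]
            gcongr
            exact subset_univ _
        _ = ENNReal.ofReal B := by
            rw [hB, ENNReal.ofReal_mul (hΨ₂.nonneg (by positivity)), ofReal_measureReal]
    have htotal : orliczModular Ψ₂ μ F (256 / A) ≤ ENNReal.ofReal (1 + B) := by
      rw [orliczModular, ← lintegral_add_compl _ hEm, ENNReal.ofReal_add zero_le_one hBn,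
        ENNReal.ofReal_one]
      exact add_le_add hlarge hsmall
    have hFone : orliczModular Ψ₂ μ F M ≤ 1 := by
      refine (orliczModular_mul_le hΨ₂ μ F (by positivity) (by linarith)).trans ?_
      refine (mul_le_mul_right htotal _).trans (le_of_eq ?_)
      rw [← ENNReal.ofReal_mul (by positivity), inv_mul_cancel₀ (by positivity), ENNReal.ofReal_one]
    refine le_of_eq_of_le (lintegral_congr_ae ?_) hFone
    filter_upwards [hμD] with z hz
    rw [hFn z hz, div_div, mul_comm M C]
  refine ⟨M, fun f hf => ?_⟩
  obtain ⟨hfd, -, C₀, hC₀, hfin⟩ := hf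
  have hne := exists_orliczModular_le_one_of_lt_top hΨ₁ areaMeasure f hC₀ hfin
  refine ⟨⟨?_, ?_⟩, ?_⟩
  · rw [← Measure.restrict_eq_self_of_ae_mem hμD]
    exact hfd.continuousOn.aestronglyMeasurable measurableSet_unitDisk
  · obtain ⟨C, hC, hmod⟩ := hne
    exact ⟨M * C, by positivity, (hunit f hfd C hC hmod).trans_lt ENNReal.one_lt_top⟩
  · rw [← div_le_iff₀' hM0]
    refine le_csInf hne fun C hC => ?_
    rw [div_le_iff₀' hM0]
    exact orliczNorm_le (mul_pos hM0 hC.1) (hunit f hfd C hC.1 hC.2)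

/-- A finite positive Borel measure on the unit disk is a finite measure `μ` on `ℂ` that does not
charge the complement of the disk. The right-hand sides are in `[0, ∞]`, where `c / 0 = ∞` for
`c > 0`. -/
theorem mainTheorem4 (μ : Measure ℂ) [IsFiniteMeasure μ] (hμ : μ unitDiskᶜ = 0)
    (Ψ₁ Ψ₂ : ℝ → ℝ) (hΨ₁ : IsOrlicz Ψ₁) (hΨ₂ : IsOrlicz Ψ₂) :
    (EmbeddingBounded Ψ₁ Ψ₂ μ →
      ∃ A : ℝ, 0 < A ∧ ∀ h : ℝ, 0 < h → h < 1 →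
        carlesonRho μ h ≤ 1 / ENNReal.ofReal (Ψ₂ (A * orliczInv Ψ₁ (1 / h ^ 2)))) ∧
    ((∃ A : ℝ, 0 < A ∧ ∀ h : ℝ, 0 < h → h < 1 →
        carlesonK μ h ≤
          ENNReal.ofReal (1 / h ^ 2) / ENNReal.ofReal (Ψ₂ (A * orliczInv Ψ₁ (1 / h ^ 2)))) →
      EmbeddingBounded Ψ₁ Ψ₂ μ) := by
  refine ⟨exists_carlesonRho_le_of_embeddingBounded hΨ₁ hΨ₂, ?_⟩
  rintro ⟨A, hA, hK⟩
  exact embeddingBounded_of_carlesonK_le hμ hΨ₁ hΨ₂ hA hK
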